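/- Let $n \ge 1$ and let $G$ be a group generated by elements $g_1,\dots,g_n$, acting by isometries on a nonempty $\mathbb{R}$-tree $(X,d)$, that is, on a geodesic metric space in which, for every geodesic triangle, each side is contained in the union of the other two. For $g \in G$ let $\|g\| := \inf\{d(x,gx) \mid x \in X\}$ be the translation length of $g$. Two $n$-tuples of elements of $G$ are called Nielsen-equivalent if one is obtained from the other by a finite (possibly empty) chain of moves of the following kinds: replace $g_i$ by $g_i^{-1}$; replace $g_i$ by $g_i g_j$ for some $j \ne i$; interchange $g_i$ and $g_j$ for some $i \neq j$. Then at least one of the following holds. 1. $G$ is a free group of rank $n$ with free basis $g_1,\dots,g_n$, the action of $G$ on $X$ is free (that is, $hx = x$ for some $x \in X$ implies $h = 1$), and for every $x \in X$ the orbit map $G \to X$, $h \mapsto hx$, is a quasi-isometric embedding, where $G$ carries the word metric with respect to the free basis $g_1,\dots,g_n$: there are constants $L \ge 1$ and $C \ge 0$ such that $\frac1L\, |u^{-1}v| - C \le d(ux,vx) \le L\,|u^{-1}v| + C$ for all $u,v\in G$, where $|\cdot|$ denotes word length in $g_1^{\pm1},\dots,g_n^{\pm1}$. 2. For every $\epsilon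 > 0$ there is a tuple $(h_1,\dots,h_n)$ of elements of $G$ that is Nielsen-equivalent to $(g_1,\dots,g_n)$ and satisfies $\|h_1\| \le \epsilon$. -/

import Mathlib

/-- `S` is (the image of) a geodesic segment from `x` to `y` in the metric space `X`. -/
def IsGeodesicSegment {X : Type*} [MetricSpace X] (S : Set X) (x y : X) : Prop :=
  ∃ γ : ℝ → X, γ 0 = x ∧ γ (dist x y) = y ∧
    (∀ s ∈ Set.Icc 0 (dist x y), ∀ t ∈ Set.Icc 0 (dist x y), dist (γ s) (γ t) = |s - t|) ∧
    S = γ '' Set.Icc 0 (dist x y)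

/-- Any two points are joined by a geodesic segment. -/
def IsGeodesicSpace (X : Type*) [MetricSpace X] : Prop :=
  ∀ x y : X, ∃ S : Set X, IsGeodesicSegment S x y

/-- `X` is a `δ`-hyperbolic geodesic metric space: all geodesic triangles are `δ`-thin, that is,
each side lies in the closed `δ`-neighbourhood of the union of the other two. -/
def IsDeltaHyperbolic (δ : ℝ) (X : Type*) [MetricSpace X] : Prop :=
  IsGeodesicSpace X ∧
    ∀ (x y z : X) (Sxy Sxz Syz : Set X),
      IsGeodesicSegment Sxy x y → IsGeodesicSegment Sxz x z → IsGeodesicSegment Syz y z →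
        ∀ p ∈ Sxy, ∃ q ∈ Sxz ∪ Syz, dist p q ≤ δ

/-- An `ℝ`-tree is a `0`-hyperbolic geodesic metric space. -/
def IsRealTree (X : Type*) [MetricSpace X] : Prop :=
  IsDeltaHyperbolic 0 X

/-- The elementary Nielsen moves on `n`-tuples of elements of `G`. -/
inductive NielsenMove {G : Type*} [Group G] {n : ℕ} : (Fin n → G) → (Fin n → G) → Prop
  | inv (M : Fin n → G) (i : Fin n) : NielsenMove M (Function.update M i (M i)⁻¹)
  | mul (M : Fin n → G) (i j : Fin n) (hij : i ≠ j) :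
      NielsenMove M (Function.update M i (M i * M j))
  | swap (M : Fin n → G) (i j : Fin n) (hij : i ≠ j) :
      NielsenMove M (M ∘ Equiv.swap i j)

/-- Two tuples are Nielsen-equivalent if a finite (possibly empty) chain of elementary Nielsen
moves transforms the first into the second. -/
def NielsenEquivalent {G : Type*} [Group G] {n : ℕ} (M M' : Fin n → G) : Prop :=
  Relation.ReflTransGen NielsenMove M M'

/-- The translation length `‖h‖ = inf {d(x, hx) | x ∈ X}`. -/
noncomputable def translationLength {G : Type*} [Group G] (X : Type*) [MetricSpace X]
    [MulAction G X] (h : G) : ℝ :=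
  ⨅ x : X, dist x (h • x)

/-- The word metric on a free group `G` with respect to a free basis `b`: the length of the
reduced word in the basis that represents `u⁻¹ * v`. -/
def freeWordDist {G : Type*} [Group G] {n : ℕ} (b : FreeGroupBasis (Fin n) G) (u v : G) : ℝ :=
  (FreeGroup.norm (b.repr (u⁻¹ * v)) : ℝ)

/-- `f : A → X` is a quasi-isometric embedding, where `A` carries the distance function `dA`. -/
def IsQuasiIsometricEmbedding {A X : Type*} [MetricSpace X] (dA : A → A → ℝ) (f : A → X) : Prop :=
  ∃ L C : ℝ, 1 ≤ L ∧ 0 ≤ C ∧ ∀ a a' : A,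
    dA a a' / L - C ≤ dist (f a) (f a') ∧ dist (f a) (f a') ≤ L * dA a a' + C

/-! Suppose the second alternative fails: for some ε > 0, every entry of every tuple equivalent to g
has translation length above ε. Fix x, put ℓ(h) = d(x, hx), and let (u|v) be the Gromov product
based at 1. The midpoint estimate `IsRealTree.translationLength_le` gives ℓ(h) + ε ≤ ℓ(h²) for all
these entries.

It suffices to find an equivalent tuple with (r⁻¹|s) + (s⁻¹|t) < ℓ(s) for all reduced words rst in
its letters, which is `StrictlyReduced`. Each letter then keeps a middle part that its neighbours
cannot cancel, so ℓ grows linearly with word length (`StrictlyReduced.exists_bound`). An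
automorphism of the free group carries this bound back to g.

If a tuple has minimal total length, a bad word pqr forces ℓ(pq) = ℓ(p) and ℓ(qr) = ℓ(r). Replacing
p by pq, or r by qr, then preserves all lengths, and one of the two increases the number of pairs of
letters with a common initial segment. A tuple maximising these counts is therefore strictly reduced
(`IsTreeLength.exists_strictlyReduced`).

The minimum need not be attained. Lengths along a minimising sequence are pulled back to the free
group, where an ultralimit attains it. Strict reducedness is finitely many strict inequalities, so
it returns to some member of the sequence. -/

/-- A based length function on a group whose left-invariant distance `ℓ (u⁻¹ * v)` is
`0`-hyperbolic. -/
structure IsTreeLength {G : Type*} [Group G] (ℓ : G → ℝ) : Prop where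
  one : ℓ 1 = 0
  inv : ∀ u, ℓ u⁻¹ = ℓ u
  fourPoint : ∀ u v w, ℓ (u⁻¹ * v) + ℓ w ≤ max (ℓ (u⁻¹ * w) + ℓ v) (ℓ (v⁻¹ * w) + ℓ u)

/-- The Gromov product of two group elements based at `1`. -/
noncomputable def lengthProduct {G : Type*} [Group G] (ℓ : G → ℝ) (u v : G) : ℝ :=
  (ℓ u + ℓ v - ℓ (u⁻¹ * v)) / 2

/-! ### Geometry of ℝ-trees. -/

theorem exists_isGeodesicSegment_point {X : Type*} [MetricSpace X] {S : Set X} {x y : X}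
    (hS : IsGeodesicSegment S x y) {t : ℝ} (ht : 0 ≤ t) (ht' : t ≤ dist x y) :
    ∃ p ∈ S, dist x p = t ∧ dist p y = dist x y - t := by
  obtain ⟨γ, h0, h1, hγ, rfl⟩ := hS
  refine ⟨γ t, ⟨t, ⟨ht, ht'⟩, rfl⟩, ?_, ?_⟩
  · have := hγ 0 ⟨le_rfl, dist_nonneg⟩ t ⟨ht, ht'⟩
    rw [h0] at this
    rw [this, zero_sub, abs_neg, abs_of_nonneg ht]
  · have := hγ t ⟨ht, ht'⟩ _ ⟨dist_nonneg, le_rfl⟩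
    rw [h1] at this
    rw [this, abs_of_nonpos (by linarith)]
    ring

theorem IsGeodesicSegment.dist_add_dist {X : Type*} [MetricSpace X] {S : Set X} {x y p : X}
    (hS : IsGeodesicSegment S x y) (hp : p ∈ S) : dist x p + dist p y = dist x y := by
  obtain ⟨γ, h0, h1, hγ, rfl⟩ := hS
  obtain ⟨t, ht, rfl⟩ := hp
  have a := hγ 0 ⟨le_rfl, dist_nonneg⟩ t ht
  have b := hγ t ht _ ⟨dist_nonneg, le_rfl⟩
  rw [h0] at a
  rw [h1] at b
  rw [a, b, zero_sub, abs_neg, abs_of_nonneg ht.1, abs_of_nonpos (by linarith [ht.2])]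
  ring

theorem IsGeodesicSegment.eq_of_dist_eq {X : Type*} [MetricSpace X] {S : Set X} {x y p q : X}
    (hS : IsGeodesicSegment S x y) (hp : p ∈ S) (hq : q ∈ S) (h : dist x p = dist x q) :
    p = q := by
  obtain ⟨γ, h0, h1, hγ, rfl⟩ := hS
  obtain ⟨t, ht, rfl⟩ := hp
  obtain ⟨s, hs, rfl⟩ := hq
  have a := hγ 0 ⟨le_rfl, dist_nonneg⟩ t ht
  have b := hγ 0 ⟨le_rfl, dist_nonneg⟩ s hs
  rw [h0, zero_sub, abs_neg, abs_of_nonneg ht.1] at a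
  rw [h0, zero_sub, abs_neg, abs_of_nonneg hs.1] at b
  rw [← a, h, b]

/-- In an `ℝ`-tree, geodesics issuing from `w` agree up to the Gromov product. -/
theorem IsRealTree.mem_segment {X : Type*} [MetricSpace X] (hX : IsRealTree X) {w x y p : X}
    {S T : Set X} (hS : IsGeodesicSegment S w x) (hT : IsGeodesicSegment T w y) (hp : p ∈ S)
    (h : 2 * dist w p < dist w x + dist w y - dist x y) : p ∈ T := by
  obtain ⟨U, hU⟩ := hX.1 x y
  obtain ⟨q, hq, hpq⟩ := hX.2 w x y S T U hS hT hU p hp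
  obtain rfl : p = q := dist_le_zero.1 hpq
  rcases hq with hq | hq
  · exact hq
  · have a := hU.dist_add_dist hq
    have b := hS.dist_add_dist hp
    have c := dist_triangle w p y
    rw [dist_comm x p] at a
    linarith

/-- If it failed, points at a distance t from w, with t beyond the Gromov product of x and y, on
[w,x] and [w,y] would both lie on [w,z] and so coincide, making d(x,y) too small. -/
theorem IsRealTree.fourPoint {X : Type*} [MetricSpace X] (hX : IsRealTree X) (x y z w : X) :
    dist x y + dist z w ≤ max (dist x z + dist y w) (dist y z + dist x w) := by
  by_contra! hlt
  obtain ⟨h1, h2⟩ := max_lt_iff.1 hlt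
  set r := min ((dist w x + dist w z - dist x z) / 2) ((dist w y + dist w z - dist y z) / 2)
    with hr
  have hr' : (dist w x + dist w y - dist x y) / 2 < r := by
    rw [dist_comm z w, dist_comm y w] at h1
    rw [dist_comm z w, dist_comm x w] at h2
    rw [hr, lt_min_iff]
    constructor <;> linarith
  obtain ⟨t, ht, htr⟩ := exists_between hr'
  obtain ⟨hx, hy⟩ := lt_min_iff.1 htr
  have ht0 : 0 ≤ t := by linarith [dist_triangle x w y, dist_comm x w]
  obtain ⟨Sx, hSx⟩ := hX.1 w x
  obtain ⟨Sy, hSy⟩ := hX.1 w y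
  obtain ⟨Sz, hSz⟩ := hX.1 w z
  obtain ⟨p, hp, hp1, hp2⟩ := exists_isGeodesicSegment_point hSx ht0
    (by linarith [dist_triangle w x z])
  obtain ⟨q, hq, hq1, hq2⟩ := exists_isGeodesicSegment_point hSy ht0
    (by linarith [dist_triangle w y z])
  have hpz := hX.mem_segment hSx hSz hp (by linarith)
  have hqz := hX.mem_segment hSy hSz hq (by linarith)
  obtain rfl := hSz.eq_of_dist_eq hpz hqz (by linarith)
  linarith [dist_triangle x p y, dist_comm x p]

theorem IsRealTree.isTreeLength {X : Type*} [MetricSpace X] (hX : IsRealTree X)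
    {G : Type*} [Group G] [MulAction G X] [IsIsometricSMul G X] (x : X) :
    IsTreeLength (fun h : G => dist x (h • x)) := by
  have key (u v : G) : dist x ((u⁻¹ * v) • x) = dist (u • x) (v • x) := by
    rw [← dist_smul u, smul_smul, mul_inv_cancel_left]
  refine ⟨by simp, fun u => ?_, fun u v w => ?_⟩
  · rw [← dist_smul u, smul_inv_smul, dist_comm]
  · simp only [key]
    have := hX.fourPoint (u • x) (v • x) (w • x) x
    simpa only [dist_comm _ x] using this

/-- The midpoint of `x` and `h • x` bounds the translation length of `h`. -/
theorem IsRealTree.translationLength_le {X : Type*} [MetricSpace X] (hX : IsRealTree X)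
    {G : Type*} [Group G] [MulAction G X] [IsIsometricSMul G X] (x : X) (h : G) :
    translationLength X h ≤ max 0 (dist x ((h * h) • x) - dist x (h • x)) := by
  obtain ⟨S, hS⟩ := hX.1 x (h • x)
  obtain ⟨y, -, h1, h2⟩ := exists_isGeodesicSegment_point hS (t := dist x (h • x) / 2)
    (by positivity) (by linarith [dist_nonneg (x := x) (y := h • x)])
  have hle : translationLength X h ≤ dist y (h • y) :=
    ciInf_le ⟨0, by rintro _ ⟨z, rfl⟩; exact dist_nonneg⟩ y
  refine hle.trans ?_
  -- The first inequality bounds d(y, hy) through d(x, hy), the second bounds d(x, hy) through d(x,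
  -- h²x).
  have a := hX.fourPoint y (h • y) x (h • x)
  have b := hX.fourPoint (h • y) x (h • x) ((h * h) • x)
  have e1 : dist (h • x) (h • y) = dist x y := dist_smul h x y
  have e2 : dist (h • y) ((h * h) • x) = dist y (h • x) := by rw [mul_smul, dist_smul]
  have e3 : dist (h • x) ((h * h) • x) = dist x (h • x) := by rw [mul_smul, dist_smul]
  rw [dist_comm (h • y) (h • x), e1, e2, e3] at b
  rw [dist_comm (h • y) (h • x), e1, dist_comm y x] at a
  rcases le_max_iff.1 a with a | a <;> rcases le_max_iff.1 b with b | b <;> rw [le_max_iff] <;>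
    first
    | (left; linarith)
    | (right; linarith)

/-! ### Gromov products of a tree length. -/

namespace IsTreeLength

variable {G : Type*} [Group G] {ℓ : G → ℝ}

theorem nonneg (h : IsTreeLength ℓ) (u : G) : 0 ≤ ℓ u := by
  have := h.fourPoint u u 1
  simp only [inv_mul_cancel, h.one, mul_one, h.inv, max_self] at this
  linarith

theorem mul_le (h : IsTreeLength ℓ) (u v : G) : ℓ (u * v) ≤ ℓ u + ℓ v := by
  have := h.fourPoint u⁻¹ v 1
  simpa [h.one, h.inv, add_comm] using this

theorem product_comm (h : IsTreeLength ℓ) (u v : G) :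
    lengthProduct ℓ u v = lengthProduct ℓ v u := by
  have : ℓ (u⁻¹ * v) = ℓ (v⁻¹ * u) := by rw [← h.inv]; simp
  rw [lengthProduct, lengthProduct, this]
  ring

theorem product_self (h : IsTreeLength ℓ) (u : G) : lengthProduct ℓ u u = ℓ u := by
  simp [lengthProduct, h.one]

theorem product_nonneg (h : IsTreeLength ℓ) (u v : G) : 0 ≤ lengthProduct ℓ u v := by
  have := h.mul_le u⁻¹ v
  rw [h.inv] at this
  rw [lengthProduct]
  linarith

theorem min_product_le (h : IsTreeLength ℓ) (u w v : G) :
    min (lengthProduct ℓ u w) (lengthProduct ℓ w v) ≤ lengthProduct ℓ u v := by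
  rw [h.product_comm w v]
  have := h.fourPoint u v w
  simp only [lengthProduct]
  rcases le_max_iff.1 this with a | a
  · exact (min_le_left _ _).trans (by linarith)
  · exact (min_le_right _ _).trans (by linarith)

theorem le_product_trans (h : IsTreeLength ℓ) {u w v : G} {r : ℝ}
    (h₁ : r ≤ lengthProduct ℓ u w) (h₂ : r ≤ lengthProduct ℓ w v) : r ≤ lengthProduct ℓ u v :=
  (le_min h₁ h₂).trans (h.min_product_le u w v)

theorem le_product_iff_left (h : IsTreeLength ℓ) {u u' : G} {r : ℝ}
    (huu' : r ≤ lengthProduct ℓ u u') (v : G) :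
    r ≤ lengthProduct ℓ u v ↔ r ≤ lengthProduct ℓ u' v :=
  ⟨h.le_product_trans (h.product_comm u u' ▸ huu'), h.le_product_trans huu'⟩

end IsTreeLength

/-! ### Strictly reduced tuples and linear growth. -/

/-- The element or its inverse, according to the sign of the letter. -/
def letter {G : Type*} [Group G] {ι : Type*} (M : ι → G) (s : ι × Bool) : G :=
  cond s.2 (M s.1) (M s.1)⁻¹

theorem letter_not {G : Type*} [Group G] {ι : Type*} (M : ι → G) (i : ι) (b : Bool) :
    letter M (i, !b) = (letter M (i, b))⁻¹ := by
  cases b <;> simp [letter]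

theorem map_letter {G H : Type*} [Group G] [Group H] {ι : Type*} (φ : G →* H) (M : ι → G)
    (s : ι × Bool) : φ (letter M s) = letter (φ ∘ M) s := by
  rcases s with ⟨i, _ | _⟩ <;> simp [letter]

theorem IsTreeLength.letter_eq {G : Type*} [Group G] {ℓ : G → ℝ} (h : IsTreeLength ℓ) {ι : Type*}
    (M : ι → G) (s : ι × Bool) : ℓ (letter M s) = ℓ (M s.1) := by
  rcases s with ⟨i, _ | _⟩ <;> simp [letter, h.inv]

/-- Two consecutive letters of a word do not cancel formally. -/
def Composable {ι : Type*} (s t : ι × Bool) : Prop := s.1 = t.1 → s.2 = t.2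

theorem Composable.refl {ι : Type*} (s : ι × Bool) : Composable s s := fun _ => rfl

/-- In a product of letters, no letter is absorbed by its two neighbours. -/
def StrictlyReduced {G : Type*} [Group G] (ℓ : G → ℝ) {ι : Type*} (M : ι → G) : Prop :=
  ∀ r s t : ι × Bool, Composable r s → Composable s t →
    ℓ (letter M r) + ℓ (letter M t) <
      ℓ (letter M r * letter M s) + ℓ (letter M s * letter M t)

/-- Local-to-global induction on words: a preceding letter t cancels no more against the whole word
than against its first letter s, and every letter contributes at least κ beyond that cancellation.
-/
theorem IsTreeLength.lift_mk_bound {G : Type*} [Group G] {ℓ : G → ℝ} (h : IsTreeLength ℓ)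
    {ι : Type*} {M : ι → G} {κ : ℝ}
    (hκ : ∀ r s t : ι × Bool, Composable r s → Composable s t →
      ℓ (letter M r) + ℓ (letter M t) + 2 * κ ≤
        ℓ (letter M r * letter M s) + ℓ (letter M s * letter M t)) (hκ0 : 0 < κ)
    (L : List (ι × Bool)) : ∀ s : ι × Bool, (s :: L).IsChain Composable →
      ∀ t, Composable t s →
        lengthProduct ℓ (letter M t)⁻¹ ((s :: L).map (letter M)).prod ≤
            lengthProduct ℓ (letter M t)⁻¹ (letter M s) ∧
          κ * (s :: L).length ≤ ℓ ((s :: L).map (letter M)).prod -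
            lengthProduct ℓ (letter M t)⁻¹ (letter M s) := by
  induction L with
  | nil =>
    intro s _ t hts
    -- A last letter has no right neighbour; repeating it supplies one.
    have a := hκ t s s hts (Composable.refl s)
    have b := h.mul_le (letter M s) (letter M s)
    simp only [List.map_cons, List.map_nil, List.prod_cons, List.prod_nil, mul_one, le_refl,
      true_and, List.length_cons, List.length_nil, lengthProduct, inv_inv, h.inv]
    push_cast
    linarith
  | cons s L ih =>
    intro t hc r hrt
    obtain ⟨hts, hc'⟩ := List.isChain_cons_cons.1 hc
    obtain ⟨h1, h2⟩ := ih s hc' t hts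
    have a := hκ r t s hrt hts
    rw [List.map_cons, List.prod_cons]
    set W := ((s :: L).map (letter M)).prod
    have m := h.min_product_le (letter M r)⁻¹ (letter M t * W) (letter M t)
    have e : lengthProduct ℓ (letter M t * W) (letter M t) =
        ℓ (letter M t) - lengthProduct ℓ (letter M t)⁻¹ W := by
      rw [h.product_comm]
      simp only [lengthProduct, inv_inv, h.inv, inv_mul_cancel_left]
      ring
    have e1 : lengthProduct ℓ (letter M r)⁻¹ (letter M t) +
        lengthProduct ℓ (letter M t)⁻¹ (letter M s) + κ ≤ ℓ (letter M t) := by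
      simp only [lengthProduct, inv_inv, h.inv]
      linarith
    have e2 : ℓ (letter M t * W) = ℓ (letter M t) + ℓ W -
        2 * lengthProduct ℓ (letter M t)⁻¹ W := by
      simp only [lengthProduct, inv_inv, h.inv]
      ring
    constructor
    -- By `e` and `e1`, (tW|t) exceeds (r⁻¹|t) by at least κ, so it cannot be the smaller product.
    · rcases min_le_iff.1 m with m | m
      · exact m
      · linarith
    · rw [e2, List.length_cons]
      push_cast
      linarith

/-- A strictly reduced tuple is freely independent, with linearly growing length. -/
theorem StrictlyReduced.exists_bound {G : Type*} [Group G] {ℓ : G → ℝ} (h : IsTreeLength ℓ)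
    {ι : Type*} [DecidableEq ι] [Finite ι] {M : ι → G} (hM : StrictlyReduced ℓ M) :
    ∃ κ : ℝ, 0 < κ ∧ ∀ w : FreeGroup ι, κ * w.norm ≤ ℓ (FreeGroup.lift M w) := by
  obtain ⟨κ, hκ0, hκ⟩ : ∃ κ : ℝ, 0 < κ ∧ ∀ r s t : ι × Bool, Composable r s → Composable s t →
      ℓ (letter M r) + ℓ (letter M t) + 2 * κ ≤
        ℓ (letter M r * letter M s) + ℓ (letter M s * letter M t) := by
    have ev : ∀ p : (ι × Bool) × (ι × Bool) × (ι × Bool),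
        ∀ᶠ κ : ℝ in nhdsWithin 0 (Set.Ioi 0), Composable p.1 p.2.1 → Composable p.2.1 p.2.2 →
          ℓ (letter M p.1) + ℓ (letter M p.2.2) + 2 * κ ≤
            ℓ (letter M p.1 * letter M p.2.1) + ℓ (letter M p.2.1 * letter M p.2.2) := by
      rintro ⟨r, s, t⟩
      by_cases h1 : Composable r s ∧ Composable s t
      · have := hM r s t h1.1 h1.2
        have hlt : (0 : ℝ) < (ℓ (letter M r * letter M s) + ℓ (letter M s * letter M t) -
          (ℓ (letter M r) + ℓ (letter M t))) / 2 := by linarith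
        filter_upwards [Ioo_mem_nhdsGT hlt] with κ hκ _ _
        linarith [hκ.2]
      · exact Filter.Eventually.of_forall fun κ a b => (h1 ⟨a, b⟩).elim
    obtain ⟨κ, h1, h2⟩ := ((Filter.eventually_all.2 ev).and self_mem_nhdsWithin).exists
    exact ⟨κ, h2, fun r s t => h1 (r, s, t)⟩
  refine ⟨κ, hκ0, fun w => ?_⟩
  have hw : FreeGroup.lift M w = (w.toWord.map (letter M)).prod := by
    conv_lhs => rw [← FreeGroup.mk_toWord (x := w)]
    rfl
  have hred : w.toWord.IsChain Composable := FreeGroup.isReduced_toWord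
  rw [hw, FreeGroup.norm]
  rcases hL : w.toWord with _ | ⟨s, L⟩
  · simp [h.one]
  · rw [hL] at hred
    have := (h.lift_mk_bound hκ hκ0 L s hred s (Composable.refl s)).2
    linarith [h.product_nonneg (letter M s)⁻¹ (letter M s)]

/-- Homomorphisms from a free group are Lipschitz for symmetric subadditive length functions. -/
theorem FreeGroup.lift_le_mul_norm {G : Type*} [Group G] {ℓ : G → ℝ} (one : ℓ 1 = 0)
    (inv : ∀ u, ℓ u⁻¹ = ℓ u) (mul : ∀ u v, ℓ (u * v) ≤ ℓ u + ℓ v)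
    {ι : Type*} [DecidableEq ι] {M : ι → G} {K : ℝ} (hK : ∀ i, ℓ (M i) ≤ K) (w : FreeGroup ι) :
    ℓ (FreeGroup.lift M w) ≤ K * w.norm := by
  have hw : FreeGroup.lift M w = (w.toWord.map (letter M)).prod := by
    conv_lhs => rw [← FreeGroup.mk_toWord (x := w)]
    rfl
  rw [hw, FreeGroup.norm]
  induction w.toWord with
  | nil => simp [one]
  | cons s L ih =>
    rw [List.map_cons, List.prod_cons, List.length_cons]
    have a := mul (letter M s) (L.map (letter M)).prod
    have b : ℓ (letter M s) = ℓ (M s.1) := by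
      rcases s with ⟨i, _ | _⟩ <;> simp [letter, inv]
    have c := hK s.1
    push_cast
    linarith

theorem IsTreeLength.lift_le {G : Type*} [Group G] {ℓ : G → ℝ} (h : IsTreeLength ℓ)
    {ι : Type*} [DecidableEq ι] {M : ι → G} {K : ℝ} (hK : ∀ i, ℓ (M i) ≤ K) (w : FreeGroup ι) :
    ℓ (FreeGroup.lift M w) ≤ K * w.norm :=
  FreeGroup.lift_le_mul_norm h.one h.inv h.mul_le hK w

/-! ### Nielsen equivalence and automorphisms of free groups. -/

theorem NielsenMove.map {G H : Type*} [Group G] [Group H] (φ : G →* H) {n : ℕ}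
    {M M' : Fin n → G} (h : NielsenMove M M') : NielsenMove (φ ∘ M) (φ ∘ M') := by
  cases h with
  | inv i =>
    rw [Function.comp_update, map_inv]
    exact .inv (φ ∘ M) i
  | mul i j hij =>
    rw [Function.comp_update, map_mul]
    exact .mul (φ ∘ M) i j hij
  | swap i j hij => exact .swap (φ ∘ M) i j hij

theorem NielsenEquivalent.map {G H : Type*} [Group G] [Group H] (φ : G →* H) {n : ℕ}
    {M M' : Fin n → G} (h : NielsenEquivalent M M') :
    NielsenEquivalent (φ ∘ M) (φ ∘ M') :=
  Relation.ReflTransGen.lift (fun N => φ ∘ N) (fun _ _ => NielsenMove.map φ) _ _ h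

theorem NielsenMove.exists_mulEquiv {G : Type*} [Group G] {n : ℕ} {M M' : Fin n → G}
    (h : NielsenMove M M') :
    ∃ α : FreeGroup (Fin n) ≃* FreeGroup (Fin n),
      ∀ w, FreeGroup.lift M' w = FreeGroup.lift M (α w) := by
  have key (f f' : Fin n → FreeGroup (Fin n))
      (h₁ : ∀ k, FreeGroup.lift f (f' k) = FreeGroup.of k)
      (h₂ : ∀ k, FreeGroup.lift f' (f k) = FreeGroup.of k)
      (h₃ : ∀ k, FreeGroup.lift M (f k) = M' k) :
      ∃ α : FreeGroup (Fin n) ≃* FreeGroup (Fin n),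
        ∀ w, FreeGroup.lift M' w = FreeGroup.lift M (α w) := by
    refine ⟨MonoidHom.toMulEquiv (FreeGroup.lift f) (FreeGroup.lift f') ?_ ?_, fun w => ?_⟩
    · ext k; simp [h₂]
    · ext k; simp [h₁]
    · have : FreeGroup.lift M' = (FreeGroup.lift M).comp (FreeGroup.lift f) := by
        ext k; simp [h₃]
      exact DFunLike.congr_fun this w
  cases h with
  | inv i =>
    refine key (Function.update FreeGroup.of i (FreeGroup.of i)⁻¹)
      (Function.update FreeGroup.of i (FreeGroup.of i)⁻¹) ?_ ?_ ?_ <;> intro k <;>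
      by_cases hk : k = i
    all_goals first | (subst hk; simp) | simp [hk]
  | mul i j hij =>
    refine key (Function.update FreeGroup.of i (FreeGroup.of i * FreeGroup.of j))
      (Function.update FreeGroup.of i (FreeGroup.of i * (FreeGroup.of j)⁻¹)) ?_ ?_ ?_ <;>
      intro k <;> by_cases hk : k = i
    all_goals first | (subst hk; simp [hij.symm]) | simp [hk]
  | swap i j hij =>
    refine key (FreeGroup.of ∘ Equiv.swap i j) (FreeGroup.of ∘ Equiv.swap i j) ?_ ?_ ?_ <;>
      intro k <;> simp

theorem NielsenEquivalent.exists_mulEquiv {G : Type*} [Group G] {n : ℕ} {M M' : Fin n → G}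
    (h : NielsenEquivalent M M') :
    ∃ α : FreeGroup (Fin n) ≃* FreeGroup (Fin n),
      ∀ w, FreeGroup.lift M' w = FreeGroup.lift M (α w) := by
  induction h with
  | refl => exact ⟨MulEquiv.refl _, fun _ => rfl⟩
  | tail _ h ih =>
    obtain ⟨α, hα⟩ := ih
    obtain ⟨β, hβ⟩ := h.exists_mulEquiv
    exact ⟨β.trans α, fun w => by rw [hβ, hα]; rfl⟩

theorem NielsenEquivalent.trans {G : Type*} [Group G] {n : ℕ} {M M' M'' : Fin n → G}
    (h : NielsenEquivalent M M') (h' : NielsenEquivalent M' M'') : NielsenEquivalent M M'' :=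
  Relation.ReflTransGen.trans h h'

/-- Replace the generator `M i` so that the letter `s` over `i` takes the value `g`. -/
def updateLetter {G : Type*} [Group G] {ι : Type*} [DecidableEq ι] (M : ι → G) (s : ι × Bool)
    (g : G) : ι → G :=
  Function.update M s.1 (cond s.2 g g⁻¹)

theorem letter_updateLetter_self {G : Type*} [Group G] {ι : Type*} [DecidableEq ι] (M : ι → G)
    (s : ι × Bool) (g : G) : letter (updateLetter M s g) s = g := by
  rcases s with ⟨i, _ | _⟩ <;> simp [letter, updateLetter]

theorem letter_updateLetter_of_ne {G : Type*} [Group G] {ι : Type*} [DecidableEq ι] (M : ι → G)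
    {s t : ι × Bool} (g : G) (h : t.1 ≠ s.1) :
    letter (updateLetter M s g) t = letter M t := by
  simp [letter, updateLetter, h]

/-- Negative letters are handled by inverting a generator, multiplying and inverting back. -/
theorem nielsenEquivalent_updateLetter {G : Type*} [Group G] {n : ℕ} (M : Fin n → G)
    {s t : Fin n × Bool} (h : s.1 ≠ t.1) :
    NielsenEquivalent M (updateLetter M s (letter M s * letter M t)) := by
  have invert (N : Fin n → G) (i : Fin n) :
      NielsenEquivalent N (Function.update N i (N i)⁻¹) := .single (.inv N i)
  have mul (N : Fin n → G) (i j : Fin n) (hij : i ≠ j) :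
      NielsenEquivalent N (Function.update N i (N i * N j)) := .single (.mul N i j hij)
  have mulInv (N : Fin n → G) (i j : Fin n) (hij : i ≠ j) :
      NielsenEquivalent N (Function.update N i (N i * (N j)⁻¹)) := by
    refine (invert N j).trans ((mul _ i j hij).trans ?_)
    convert invert _ j using 1
    ext k
    by_cases hk : k = j
    · subst hk; simp [hij.symm]
    · by_cases hk' : k = i
      · subst hk'; simp [hk]
      · simp [hk, hk']
  have right (N : Fin n → G) (i : Fin n) (hi : i ≠ t.1) :
      NielsenEquivalent N (Function.update N i (N i * letter N t)) := by
    obtain ⟨j, _ | _⟩ := t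
    · exact mulInv N i j hi
    · exact mul N i j hi
  obtain ⟨i, _ | _⟩ := s
  · refine (invert M i).trans ((right _ i h).trans ?_)
    convert invert _ i using 1
    ext k
    by_cases hk : k = i
    · subst hk
      simp [updateLetter, letter, Ne.symm h]
    · simp [updateLetter, hk]
  · exact right M i h

/-! ### Counting related pairs and lexicographic maxima. -/

open Classical in
/-- The number of related pairs. -/
noncomputable def relCount {E : Type*} [Fintype E] (R : E → E → Prop) : ℕ :=
  ∑ s, ∑ t, if R s t then 1 else 0

theorem relCount_le {E : Type*} [Fintype E] (R : E → E → Prop) :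
    relCount R ≤ Fintype.card E * Fintype.card E := by
  classical
  calc relCount R ≤ ∑ _s : E, ∑ _t : E, 1 :=
        Finset.sum_le_sum fun s _ => Finset.sum_le_sum fun t _ => by split_ifs <;> simp
    _ = _ := by simp

open Classical in
theorem relCount_eq {E : Type*} [Fintype E] {R : E → E → Prop} (hs : ∀ s t, R s t → R t s)
    {e : E} (he : R e e) :
    relCount R = (∑ s ∈ Finset.univ.erase e, ∑ t ∈ Finset.univ.erase e, if R s t then 1 else 0) +
      2 * ((Finset.univ.erase e).filter (R e)).card + 1 := by
  have split (f : E → ℕ) : ∑ s, f s = (∑ s ∈ Finset.univ.erase e, f s) + f e :=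
    (Finset.sum_erase_add _ _ (Finset.mem_univ e)).symm
  have hsym : ∀ s, (if R s e then 1 else 0) = if R e s then 1 else 0 := fun s => by
    congr 1; exact propext ⟨hs _ _, hs _ _⟩
  rw [relCount, split]
  simp only [split, Finset.sum_add_distrib, hsym, he, if_true, Finset.card_filter]
  ring

open Classical in
-- When only the relations of e change, the two counts differ by twice the change in the number of
-- other elements related to e.
theorem relCount_lt {E : Type*} [Fintype E] {R R' : E → E → Prop} (hs : ∀ s t, R s t → R t s)
    (hs' : ∀ s t, R' s t → R' t s) {e : E} (he : R e e) (he' : R' e e)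
    (heq : ∀ s ≠ e, ∀ t ≠ e, (R s t ↔ R' s t))
    (hlt : ((Finset.univ.erase e).filter (R e)).card <
      ((Finset.univ.erase e).filter (R' e)).card) : relCount R < relCount R' := by
  rw [relCount_eq hs he, relCount_eq hs' he']
  have : (∑ s ∈ Finset.univ.erase e, ∑ t ∈ Finset.univ.erase e, if R s t then 1 else 0) =
      ∑ s ∈ Finset.univ.erase e, ∑ t ∈ Finset.univ.erase e, if R' s t then 1 else 0 :=
    Finset.sum_congr rfl fun s hs => Finset.sum_congr rfl fun t ht => by
      rw [heq s (Finset.ne_of_mem_erase hs) t (Finset.ne_of_mem_erase ht)]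
  omega

/-- A lexicographic maximum of a finite family of bounded functions. -/
theorem exists_lex_max {α : Type*} {P : α → Prop} (hP : ∃ a, P a) (f : ℝ → α → ℕ) (B : ℕ)
    (hB : ∀ r a, f r a ≤ B) (S : Finset ℝ) :
    ∃ a, P a ∧ ∀ a', P a' → ∀ r ∈ S, (∀ r' ∈ S, r' < r → f r' a' = f r' a) →
      f r a' ≤ f r a := by
  -- Adding the largest index last gives smaller indices priority.
  induction S using Finset.induction_on_max with
  | empty => simpa using hP
  | insert m S hm ih =>
    obtain ⟨a₀, ha₀, hmax⟩ := ih
    let V : Set ℕ := {k | ∃ a, P a ∧ (∀ r ∈ S, f r a = f r a₀) ∧ f m a = k}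
    have hV : V.Nonempty := ⟨_, a₀, ha₀, fun _ _ => rfl, rfl⟩
    have hb : BddAbove V := ⟨B, by rintro _ ⟨a, -, -, rfl⟩; exact hB m a⟩
    obtain ⟨a, ha, hSa, hma⟩ := Nat.sSup_mem hV hb
    refine ⟨a, ha, fun a' ha' r hr hr' => ?_⟩
    rcases Finset.mem_insert.1 hr with rfl | hr
    · rw [hma]
      exact le_csSup hb ⟨a', ha', fun r' h' => by
        rw [hr' r' (Finset.mem_insert_of_mem h') (hm r' h'), hSa r' h'], rfl⟩
    · rw [hSa r hr]
      exact hmax a' ha' r hr fun r' h' hlt => by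
        rw [hr' r' (Finset.mem_insert_of_mem h') hlt, hSa r' h']

/-! ### Effect of a length-preserving move on common initial segments. -/

/-- The letters `s` and `t` share an initial segment of length at least `r`. -/
def ShareInitial {G : Type*} [Group G] (ℓ : G → ℝ) {ι : Type*} (M : ι → G) (r : ℝ)
    (s t : ι × Bool) : Prop :=
  r ≤ lengthProduct ℓ (letter M s) (letter M t)

open Classical in
/-- The number of letters whose initial segment of length `r` is that of `g`. -/
noncomputable def shareCount {G : Type*} [Group G] (ℓ : G → ℝ) {ι : Type*} [Fintype ι]
    (M : ι → G) (r : ℝ) (g : G) : ℕ :=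
  (Finset.univ.filter fun t : ι × Bool => r ≤ lengthProduct ℓ g (letter M t)).card

section Improve

variable {G : Type*} [Group G] {ℓ : G → ℝ} {ι : Type*} {M : ι → G} {s t : ι × Bool}

/-- Here (s⁻¹|t) = ℓ(t)/2, so s⁻¹ follows t up to radius ℓ(t)/2. -/
theorem IsTreeLength.shareInitial_inv_iff (h : IsTreeLength ℓ)
    (hlen : ℓ (letter M s * letter M t) = ℓ (letter M s)) {ρ : ℝ}
    (hρ : ρ ≤ ℓ (letter M t) / 2) (y : ι × Bool) :
    ShareInitial ℓ M ρ (s.1, !s.2) y ↔ ρ ≤ lengthProduct ℓ (letter M t) (letter M y) := by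
  refine h.le_product_iff_left ?_ _
  rw [letter_not]
  simp only [lengthProduct, inv_inv, h.inv, hlen]
  linarith

theorem IsTreeLength.shareInitial_self (h : IsTreeLength ℓ) {ρ : ℝ} (hρ : ρ ≤ ℓ (letter M s)) :
    ShareInitial ℓ M ρ s s := by
  rwa [ShareInitial, h.product_self]

theorem IsTreeLength.shareInitial_symm (h : IsTreeLength ℓ) {ρ : ℝ} (x y : ι × Bool)
    (hxy : ShareInitial ℓ M ρ x y) : ShareInitial ℓ M ρ y x := by
  rwa [ShareInitial, h.product_comm]

variable [DecidableEq ι]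

/-- Since (s|st) = ℓ(s) - ℓ(t)/2 ≥ ℓ(t)/2, the move does not affect the start of s; only s⁻¹ changes
direction. -/
theorem IsTreeLength.le_product_updateLetter_iff (h : IsTreeLength ℓ)
    (hlen : ℓ (letter M s * letter M t) = ℓ (letter M s))
    (hle : ℓ (letter M t) ≤ ℓ (letter M s)) {ρ : ℝ} (hρ : ρ ≤ ℓ (letter M t) / 2)
    {x : ι × Bool} (hx : x ≠ (s.1, !s.2)) (z : G) :
    ρ ≤ lengthProduct ℓ (letter M x) z ↔
      ρ ≤ lengthProduct ℓ (letter (updateLetter M s (letter M s * letter M t)) x) z := by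
  by_cases hxs : x.1 = s.1
  · obtain rfl : x = s := by
      obtain ⟨i, a⟩ := x
      obtain ⟨j, b⟩ := s
      obtain rfl : i = j := hxs
      revert hx
      cases a <;> cases b <;> simp
    rw [letter_updateLetter_self]
    refine h.le_product_iff_left ?_ z
    simp only [lengthProduct, inv_mul_cancel_left, hlen]
    linarith
  · rw [letter_updateLetter_of_ne _ _ hxs]

theorem IsTreeLength.shareInitial_updateLetter_iff (h : IsTreeLength ℓ)
    (hlen : ℓ (letter M s * letter M t) = ℓ (letter M s))
    (hle : ℓ (letter M t) ≤ ℓ (letter M s)) {ρ : ℝ} (hρ : ρ ≤ ℓ (letter M t) / 2)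
    {x y : ι × Bool} (hx : x ≠ (s.1, !s.2)) (hy : y ≠ (s.1, !s.2)) :
    ShareInitial ℓ M ρ x y ↔
      ShareInitial ℓ (updateLetter M s (letter M s * letter M t)) ρ x y := by
  rw [ShareInitial, ShareInitial, h.le_product_updateLetter_iff hlen hle hρ hx,
    h.product_comm, h.le_product_updateLetter_iff hlen hle hρ hy, h.product_comm]

/-- After the move, (st)⁻¹ follows t⁻¹ instead of t up to radius ℓ(t)/2. -/
theorem IsTreeLength.shareInitial_updateLetter_inv_iff (h : IsTreeLength ℓ)
    (hlen : ℓ (letter M s * letter M t) = ℓ (letter M s))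
    (hle : ℓ (letter M t) ≤ ℓ (letter M s)) {ρ : ℝ} (hρ : ρ ≤ ℓ (letter M t) / 2)
    {y : ι × Bool} (hy : y ≠ (s.1, !s.2)) :
    ShareInitial ℓ (updateLetter M s (letter M s * letter M t)) ρ (s.1, !s.2) y ↔
      ρ ≤ lengthProduct ℓ (letter M t)⁻¹ (letter M y) := by
  rw [h.product_comm (letter M t)⁻¹, h.le_product_updateLetter_iff hlen hle hρ hy,
    h.product_comm _ (letter M t)⁻¹]
  refine h.le_product_iff_left ?_ _
  rw [letter_not, letter_updateLetter_self]
  simp only [lengthProduct, inv_inv, h.inv, mul_inv_cancel_right, hlen]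
  linarith

variable [Fintype ι]

theorem IsTreeLength.relCount_updateLetter_eq (h : IsTreeLength ℓ)
    (hlen : ℓ (letter M s * letter M t) = ℓ (letter M s))
    (hle : ℓ (letter M t) ≤ ℓ (letter M s)) {ρ : ℝ} (hρ : ρ ≤ ℓ (letter M t) / 2)
    (hρ' : ρ ≤ lengthProduct ℓ (letter M t) (letter M t)⁻¹) :
    relCount (ShareInitial ℓ (updateLetter M s (letter M s * letter M t)) ρ) =
      relCount (ShareInitial ℓ M ρ) := by
  have e : ∀ y ≠ (s.1, !s.2),
      (ShareInitial ℓ (updateLetter M s (letter M s * letter M t)) ρ (s.1, !s.2) y ↔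
        ShareInitial ℓ M ρ (s.1, !s.2) y) := fun y hy => by
    rw [h.shareInitial_updateLetter_inv_iff hlen hle hρ hy, h.shareInitial_inv_iff hlen hρ,
      h.le_product_iff_left hρ']
  have h0 : 0 ≤ ℓ (letter M t) := h.nonneg _
  congr 1
  ext x y
  by_cases hx : x = (s.1, !s.2) <;> by_cases hy : y = (s.1, !s.2)
  · subst hx
    subst hy
    refine iff_of_true (h.shareInitial_self ?_) (h.shareInitial_self ?_)
    · rw [letter_not, letter_updateLetter_self, h.inv, hlen]
      linarith
    · rw [letter_not, h.inv]
      linarith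
  · subst hx
    exact e y hy
  · subst hy
    exact ⟨fun a => h.shareInitial_symm _ _ ((e x hx).1 (h.shareInitial_symm _ _ a)),
      fun a => h.shareInitial_symm _ _ ((e x hx).2 (h.shareInitial_symm _ _ a))⟩
  · exact (h.shareInitial_updateLetter_iff hlen hle hρ hx hy).symm

/-- Beyond (t|t⁻¹) the classes of t and t⁻¹ are disjoint. The letter s⁻¹ belongs to the class of t
before the move, so excluding it from its own neighbours makes the comparison strict. -/
theorem IsTreeLength.relCount_lt_updateLetter (h : IsTreeLength ℓ)
    (hlen : ℓ (letter M s * letter M t) = ℓ (letter M s))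
    (hle : ℓ (letter M t) ≤ ℓ (letter M s)) {ρ : ℝ} (hρ : ρ ≤ ℓ (letter M t) / 2)
    (hρ' : lengthProduct ℓ (letter M t) (letter M t)⁻¹ < ρ)
    (hcount : shareCount ℓ M ρ (letter M t) ≤ shareCount ℓ M ρ (letter M t)⁻¹) :
    relCount (ShareInitial ℓ M ρ) <
      relCount (ShareInitial ℓ (updateLetter M s (letter M s * letter M t)) ρ) := by
  classical
  have h0 : 0 ≤ ℓ (letter M t) := h.nonneg _
  have hee : ShareInitial ℓ M ρ (s.1, !s.2) (s.1, !s.2) :=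
    h.shareInitial_self (by rw [letter_not, h.inv]; linarith)
  refine relCount_lt (e := (s.1, !s.2)) h.shareInitial_symm h.shareInitial_symm hee
    (h.shareInitial_self ?_)
    (fun x hx y hy => h.shareInitial_updateLetter_iff hlen hle hρ hx hy) ?_
  · rw [letter_not, letter_updateLetter_self, h.inv, hlen]
    linarith
  have het := (h.shareInitial_inv_iff hlen hρ _).1 hee
  have hnot : ¬ ρ ≤ lengthProduct ℓ (letter M t)⁻¹ (letter M (s.1, !s.2)) := fun a =>
    hρ'.not_ge (h.le_product_trans het (h.product_comm _ (letter M t)⁻¹ ▸ a))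
  have e₁ : (Finset.univ.erase (s.1, !s.2)).filter (ShareInitial ℓ M ρ (s.1, !s.2)) =
      (Finset.univ.filter fun y => ρ ≤ lengthProduct ℓ (letter M t) (letter M y)).erase
        (s.1, !s.2) := by
    ext y
    simp [h.shareInitial_inv_iff hlen hρ]
  have e₂ : (Finset.univ.erase (s.1, !s.2)).filter (ShareInitial ℓ
      (updateLetter M s (letter M s * letter M t)) ρ (s.1, !s.2)) =
      Finset.univ.filter fun y => ρ ≤ lengthProduct ℓ (letter M t)⁻¹ (letter M y) := by
    ext y
    by_cases hy : y = (s.1, !s.2)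
    · subst hy
      simp [hnot]
    · simp [hy, h.shareInitial_updateLetter_inv_iff hlen hle hρ hy]
  have hlt := Nat.lt_of_lt_of_le (Finset.card_erase_lt_of_mem (Finset.mem_filter.2
    ⟨Finset.mem_univ (s.1, !s.2), het⟩)) hcount
  rw [shareCount, ← e₁, ← e₂] at hlt
  convert hlt

end Improve

/-! ### Minimal tuples. -/

/-- A tuple of minimal total length, all of whose Nielsen equivalents consist of hyperbolic
elements, is Nielsen equivalent to a strictly reduced one. -/
theorem IsTreeLength.exists_strictlyReduced {G : Type*} [Group G] {ℓ : G → ℝ}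
    (h : IsTreeLength ℓ) {n : ℕ} {M₀ : Fin n → G}
    (hmin : ∀ M, NielsenEquivalent M₀ M → ∑ i, ℓ (M₀ i) ≤ ∑ i, ℓ (M i))
    (hhyp : ∀ M, NielsenEquivalent M₀ M → ∀ i, ℓ (M i) < ℓ (M i * M i)) :
    ∃ M, NielsenEquivalent M₀ M ∧ StrictlyReduced ℓ M := by
  obtain ⟨M, ⟨hM, hlen⟩, hmax⟩ := exists_lex_max
    (P := fun M => NielsenEquivalent M₀ M ∧ ∀ i, ℓ (M i) = ℓ (M₀ i))
    ⟨M₀, Relation.ReflTransGen.refl, fun _ => rfl⟩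
    (fun r M => relCount (ShareInitial ℓ M r)) _ (fun _ _ => relCount_le _)
    (Finset.univ.image fun i => ℓ (M₀ i) / 2)
  refine ⟨M, hM, ?_⟩
  have hsq (s : Fin n × Bool) : ℓ (letter M s) < ℓ (letter M s * letter M s) := by
    have := hhyp M hM s.1
    rcases s with ⟨i, _ | _⟩
    · rw [← h.inv (letter M (i, false) * letter M (i, false))]
      simpa [letter, h.inv] using this
    · exact this
  have left {s t : Fin n × Bool} (hst : s.1 ≠ t.1) :
      ℓ (letter M s) ≤ ℓ (letter M s * letter M t) := by
    by_contra! hlt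
    refine (hmin _ (hM.trans (nielsenEquivalent_updateLetter M hst))).not_gt ?_
    simp_rw [← hlen]
    have e : ℓ (updateLetter M s (letter M s * letter M t) s.1) =
        ℓ (letter M s * letter M t) := by
      rw [← h.letter_eq _ s, letter_updateLetter_self]
    refine Finset.sum_lt_sum (fun i _ => ?_) ⟨s.1, Finset.mem_univ _, ?_⟩
    · by_cases hi : i = s.1
      · subst hi
        rw [e, ← h.letter_eq M s]
        exact hlt.le
      · simp [updateLetter, hi]
    · rwa [e, ← h.letter_eq M s]
  have inv_mul_inv (s t : Fin n × Bool) :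
      ℓ (letter M (s.1, !s.2) * letter M (t.1, !t.2)) = ℓ (letter M t * letter M s) := by
    rw [letter_not, letter_not, ← mul_inv_rev, h.inv]
  have right {s t : Fin n × Bool} (hst : s.1 ≠ t.1) :
      ℓ (letter M t) ≤ ℓ (letter M s * letter M t) := by
    have := left (s := (t.1, !t.2)) (t := (s.1, !s.2)) hst.symm
    rwa [inv_mul_inv, letter_not, h.inv] at this
  have comp {s t : Fin n × Bool} (hst : Composable s t) (he : s.1 = t.1) : s = t :=
    Prod.ext he (hst he)
  have optimal {s t : Fin n × Bool} (hst : s.1 ≠ t.1)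
      (hl : ℓ (letter M s * letter M t) = ℓ (letter M s)) {r : ℝ}
      (hrS : r ∈ Finset.univ.image fun i => ℓ (M₀ i) / 2) (hr : r ≤ ℓ (letter M t) / 2)
      (hrt : lengthProduct ℓ (letter M t) (letter M t)⁻¹ < r)
      (hrmin : ∀ ρ ∈ Finset.univ.image fun i => ℓ (M₀ i) / 2, ρ < r →
        ρ ≤ lengthProduct ℓ (letter M t) (letter M t)⁻¹) :
      shareCount ℓ M r (letter M t)⁻¹ < shareCount ℓ M r (letter M t) := by
    by_contra! hcount
    have hle : ℓ (letter M t) ≤ ℓ (letter M s) := hl ▸ right hst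
    refine (hmax (updateLetter M s (letter M s * letter M t))
      ⟨hM.trans (nielsenEquivalent_updateLetter M hst), fun i => ?_⟩ r hrS fun ρ hρ hρr =>
        h.relCount_updateLetter_eq hl hle (hρr.le.trans hr) (hrmin ρ hρ hρr)).not_gt
      (h.relCount_lt_updateLetter hl hle hr hrt hcount)
    rw [← hlen]
    by_cases hi : i = s.1
    · subst hi
      rw [← h.letter_eq _ s, letter_updateLetter_self, hl, h.letter_eq]
    · simp [updateLetter, hi]
  intro p q r hpq hqr
  by_contra! hbad
  -- With `hr` and `hbad`, this forces ℓ(pq) = ℓ(p) and ℓ(qr) = ℓ(r).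
  have hp : ℓ (letter M p) ≤ ℓ (letter M p * letter M q) := by
    by_cases he : p.1 = q.1
    · rw [← comp hpq he]
      exact (hsq p).le
    · exact left he
  have hr : ℓ (letter M r) ≤ ℓ (letter M q * letter M r) := by
    by_cases he : q.1 = r.1
    · rw [comp hqr he]
      exact (hsq r).le
    · exact right he
  have hpq' : p.1 ≠ q.1 := fun he => by
    have := hsq p
    rw [← comp hpq he] at hbad hr
    linarith
  have hqr' : q.1 ≠ r.1 := fun he => by
    have := hsq r
    rw [comp hqr he] at hbad hp
    linarith
  set S := Finset.univ.image fun i => ℓ (M₀ i) / 2 with hS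
  set c := lengthProduct ℓ (letter M q) (letter M q)⁻¹ with hc
  have hq : c < ℓ (letter M q) / 2 := by
    have := hsq q
    rw [hc, lengthProduct, ← mul_inv_rev, h.inv, h.inv]
    linarith
  have hqS : ℓ (letter M q) / 2 ∈ S.filter (c < ·) := by
    refine Finset.mem_filter.2 ⟨Finset.mem_image.2 ⟨q.1, Finset.mem_univ _, ?_⟩, hq⟩
    rw [h.letter_eq, hlen]
  -- This is the first radius at which q and q⁻¹ are distinguished; counts at smaller radii in `S`
  -- survive both moves.
  set m := (S.filter (c < ·)).min' ⟨_, hqS⟩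
  obtain ⟨hmS, hcm⟩ := Finset.mem_filter.1 ((S.filter (c < ·)).min'_mem ⟨_, hqS⟩)
  have hmq : m ≤ ℓ (letter M q) / 2 := Finset.min'_le _ _ hqS
  have hmmin : ∀ ρ ∈ S, ρ < m → ρ ≤ c := fun ρ hρ hρm => by
    by_contra! hlt
    exact (Finset.min'_le _ _ (Finset.mem_filter.2 ⟨hρ, hlt⟩)).not_gt hρm
  have o₁ := optimal hpq' (by linarith) hmS hmq hcm hmmin
  have hc' : lengthProduct ℓ (letter M (q.1, !q.2)) (letter M (q.1, !q.2))⁻¹ = c := by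
    rw [letter_not, inv_inv, h.product_comm]
  -- The move r ↦ qr, read on inverses, exchanges the roles of q and q⁻¹ and gives the opposite
  -- strict inequality.
  have o₂ := optimal (s := (r.1, !r.2)) (t := (q.1, !q.2)) hqr'.symm
    (by rw [inv_mul_inv, letter_not, h.inv]; linarith) hmS
    (by rwa [letter_not, h.inv]) (by rwa [hc']) (by rwa [hc'])
  rw [letter_not, inv_inv] at o₂
  exact o₁.not_gt o₂

/-! ### Passing to a limit where the minimum is attained. -/

open Filter Topology in
/-- Along an ultrafilter, uniformly Lipschitz tree lengths on a free group converge to a tree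
length. -/
theorem exists_limit_treeLength {ι : Type*} [DecidableEq ι] {U : Ultrafilter ℕ}
    {f : ℕ → FreeGroup ι → ℝ} (hf : ∀ k, IsTreeLength (f k)) {K : ℝ}
    (hK : ∀ k w, f k w ≤ K * w.norm) :
    ∃ ℓ : FreeGroup ι → ℝ, IsTreeLength ℓ ∧ ∀ w, Tendsto (fun k => f k w) U (𝓝 (ℓ w)) := by
  have lim (w : FreeGroup ι) : ∃ a, Tendsto (fun k => f k w) U (𝓝 a) := by
    obtain ⟨a, -, ha⟩ := (isCompact_Icc (a := 0) (b := K * (w.norm : ℝ))).ultrafilter_le_nhds'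
      (U.map fun k => f k w)
      (Ultrafilter.mem_map.2 <| Eventually.of_forall (f := (U : Filter ℕ)) fun k =>
        ⟨(hf k).nonneg w, hK k w⟩)
    exact ⟨a, ha⟩
  choose ℓ hℓ using lim
  refine ⟨ℓ, ⟨?_, fun u => ?_, fun u v w => ?_⟩, hℓ⟩
  · exact tendsto_nhds_unique (hℓ 1) (by simp [(hf _).one])
  · refine tendsto_nhds_unique (hℓ u⁻¹) ?_
    simp_rw [(hf _).inv]
    exact hℓ u
  · exact le_of_tendsto_of_tendsto ((hℓ _).add (hℓ _))
      (((hℓ _).add (hℓ _)).max ((hℓ _).add (hℓ _)))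
      (Eventually.of_forall fun k => (hf k).fourPoint u v w)

theorem IsTreeLength.comp {G H : Type*} [Group G] [Group H] {ℓ : G → ℝ} (h : IsTreeLength ℓ)
    (φ : H →* G) : IsTreeLength (fun w => ℓ (φ w)) := by
  refine ⟨by simp [h.one], fun u => by rw [map_inv, h.inv], fun u v w => ?_⟩
  simpa using h.fourPoint (φ u) (φ v) (φ w)

open Filter Topology in
/-- If the elements of all Nielsen equivalent tuples are uniformly hyperbolic, then some Nielsen
equivalent tuple is strictly reduced. -/
theorem IsTreeLength.exists_strictlyReduced_of_uniform {G : Type*} [Group G] {ℓ : G → ℝ}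
    (h : IsTreeLength ℓ) {n : ℕ} {g : Fin n → G} {ε : ℝ} (hε : 0 < ε)
    (hhyp : ∀ M, NielsenEquivalent g M → ∀ i, ℓ (M i) + ε ≤ ℓ (M i * M i)) :
    ∃ M, NielsenEquivalent g M ∧ StrictlyReduced ℓ M := by
  set V : Set ℝ := {a | ∃ M, NielsenEquivalent g M ∧ ∑ i, ℓ (M i) = a} with hV
  have hne : V.Nonempty := ⟨_, g, Relation.ReflTransGen.refl, rfl⟩
  have hbd : BddBelow V :=
    ⟨0, by rintro _ ⟨M, -, rfl⟩; exact Finset.sum_nonneg fun i _ => h.nonneg _⟩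
  have hσ (M) (hM : NielsenEquivalent g M) : sInf V ≤ ∑ i, ℓ (M i) := csInf_le hbd ⟨M, hM, rfl⟩
  have hex (k : ℕ) : ∃ M, NielsenEquivalent g M ∧ ∑ i, ℓ (M i) < sInf V + 1 / ((k : ℝ) + 1) := by
    obtain ⟨_, ⟨M, hM, rfl⟩, hlt⟩ := exists_lt_of_csInf_lt hne
      (lt_add_of_pos_right (sInf V) (Nat.one_div_pos_of_nat (α := ℝ) (n := k)))
    exact ⟨M, hM, hlt⟩
  choose M hM hMlt using hex
  have hf (k : ℕ) := h.comp (FreeGroup.lift (M k))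
  have hK (k : ℕ) (w : FreeGroup (Fin n)) :
      ℓ (FreeGroup.lift (M k) w) ≤ (sInf V + 1) * w.norm := by
    refine h.lift_le (fun i => ?_) w
    have a := Finset.single_le_sum (fun i _ => h.nonneg (M k i)) (Finset.mem_univ i)
    have b : 1 / ((k : ℝ) + 1) ≤ 1 := by
      rw [div_le_one (by positivity)]
      linarith [(Nat.cast_nonneg k : (0 : ℝ) ≤ k)]
    linarith [hMlt k]
  obtain ⟨ℓ', h', hlim⟩ := exists_limit_treeLength (U := hyperfilter ℕ) hf hK
  have hcomp (k : ℕ) (N : Fin n → FreeGroup (Fin n)) (hN : NielsenEquivalent FreeGroup.of N) :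
      NielsenEquivalent g (FreeGroup.lift (M k) ∘ N) := by
    have e : FreeGroup.lift (M k) ∘ FreeGroup.of = M k := by ext i; simp
    have := hN.map (FreeGroup.lift (M k))
    rw [e] at this
    exact (hM k).trans this
  have htop : Tendsto (fun k : ℕ => sInf V + 1 / ((k : ℝ) + 1)) (hyperfilter ℕ)
      (𝓝 (sInf V + 0)) :=
    (tendsto_const_nhds.add tendsto_one_div_add_atTop_nhds_zero_nat).mono_left
      Nat.hyperfilter_le_atTop
  -- In the limit the standard basis has total length at most `sInf V` and its equivalents at least
  -- that. The uniform ε keeps hyperbolicity strict.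
  obtain ⟨N, hN, hNred⟩ := h'.exists_strictlyReduced (M₀ := FreeGroup.of)
    (fun N hN => by
      refine le_trans (b := sInf V) ?_ ?_
      · rw [← add_zero (sInf V)]
        refine le_of_tendsto_of_tendsto (tendsto_finsetSum _ fun i _ => hlim (FreeGroup.of i))
          htop (Eventually.of_forall fun k => ?_)
        simpa using (hMlt k).le
      · exact ge_of_tendsto (tendsto_finsetSum _ fun i _ => hlim (N i))
          (Eventually.of_forall fun k => hσ _ (hcomp k N hN)))
    (fun N hN i => by
      have : ℓ' (N i) + ε ≤ ℓ' (N i * N i) :=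
        le_of_tendsto_of_tendsto ((hlim _).add_const ε) (hlim _)
          (Eventually.of_forall fun k => by
            simp only [map_mul]
            exact hhyp _ (hcomp k N hN) i)
      linarith)
  have hev : ∀ p : (Fin n × Bool) × (Fin n × Bool) × (Fin n × Bool),
      ∀ᶠ k in (hyperfilter ℕ : Filter ℕ), Composable p.1 p.2.1 → Composable p.2.1 p.2.2 →
        ℓ (FreeGroup.lift (M k) (letter N p.1)) + ℓ (FreeGroup.lift (M k) (letter N p.2.2)) <
          ℓ (FreeGroup.lift (M k) (letter N p.1 * letter N p.2.1)) +
            ℓ (FreeGroup.lift (M k) (letter N p.2.1 * letter N p.2.2)) := by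
    rintro ⟨r, s, t⟩
    by_cases hc : Composable r s ∧ Composable s t
    · exact (((hlim _).add (hlim _)).eventually_lt ((hlim _).add (hlim _))
        (hNred r s t hc.1 hc.2)).mono fun k hk _ _ => hk
    · exact Eventually.of_forall fun k a b => (hc ⟨a, b⟩).elim
  obtain ⟨k, hk⟩ := (eventually_all.2 hev).exists
  refine ⟨FreeGroup.lift (M k) ∘ N, hcomp k N hN, fun r s t hrs hst => ?_⟩
  have := hk (r, s, t) hrs hst
  simpa only [map_mul, map_letter] using this

/-! ### Return to the given generators. -/

theorem FreeGroup.exists_norm_map_le {ι κ : Type*} [Finite ι] [DecidableEq ι] [DecidableEq κ]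
    (φ : FreeGroup ι →* FreeGroup κ) :
    ∃ K : ℝ, 0 < K ∧ ∀ w, ((φ w).norm : ℝ) ≤ K * w.norm := by
  cases nonempty_fintype ι
  refine ⟨∑ i, ((φ (.of i)).norm : ℝ) + 1, by positivity, fun w => ?_⟩
  have hφ : FreeGroup.lift (φ ∘ FreeGroup.of) = φ := by ext; simp
  have := FreeGroup.lift_le_mul_norm (ℓ := fun w : FreeGroup κ => (w.norm : ℝ))
    (M := φ ∘ FreeGroup.of) (K := ∑ i, ((φ (.of i)).norm : ℝ) + 1) (by simp) (by simp)
    (fun u v => by exact_mod_cast FreeGroup.norm_mul_le u v) (fun i => ?_) w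
  · rwa [hφ] at this
  · have := Finset.single_le_sum (f := fun i => ((φ (.of i)).norm : ℝ))
      (fun i _ => Nat.cast_nonneg _) (Finset.mem_univ i)
    exact this.trans (le_add_of_nonneg_right zero_le_one)

/-- A nontrivial element has infinitely many distinct powers, but only finitely many words have
bounded length. -/
theorem FreeGroup.eq_one_of_norm_pow_le {ι : Type*} [Finite ι] [DecidableEq ι] {w : FreeGroup ι}
    {C : ℝ} (h : ∀ m : ℕ, ((w ^ m).norm : ℝ) ≤ C) : w = 1 := by
  by_contra hw
  have hinj : Function.Injective fun m : ℕ => (w ^ m).toWord :=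
    FreeGroup.toWord_injective.comp (injective_pow_iff_not_isOfFinOrder.2
      (not_isOfFinOrder_of_isMulTorsionFree hw))
  refine Set.infinite_range_of_injective hinj
    ((List.finite_length_le (ι × Bool) ⌊C⌋₊).subset ?_)
  rintro _ ⟨m, rfl⟩
  exact Nat.le_floor (h m)

theorem corollary2 {n : ℕ} (hn : 0 < n) {G : Type*} [Group G]
    {X : Type*} [MetricSpace X] [Nonempty X] (hX : IsRealTree X)
    [MulAction G X] [IsIsometricSMul G X]
    (g : Fin n → G) (hg : Subgroup.closure (Set.range g) = ⊤) :
    (∃ b : FreeGroupBasis (Fin n) G, (∀ i, b i = g i) ∧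
        (∀ x : X, MulAction.stabilizer G x = ⊥) ∧
        ∀ x : X, IsQuasiIsometricEmbedding (freeWordDist b) (fun h : G => h • x)) ∨
      (∀ ε : ℝ, 0 < ε → ∃ h : Fin n → G,
        NielsenEquivalent g h ∧ translationLength X (h ⟨0, hn⟩) ≤ ε) := by
  rw [or_iff_not_imp_right]
  intro hlong
  push Not at hlong
  obtain ⟨ε, hε, hlong⟩ := hlong
  obtain ⟨x⟩ := ‹Nonempty X›
  have htl (M) (hM : NielsenEquivalent g M) (i : Fin n) : ε < translationLength X (M i) := by
    by_cases hi : i = ⟨0, hn⟩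
    · exact hi ▸ hlong M hM
    -- A swap brings any entry to position 0.
    · have := hlong _ (hM.trans (.single (.swap M i ⟨0, hn⟩ hi)))
      simpa using this
  have htree := hX.isTreeLength (G := G) x
  obtain ⟨M, hM, hred⟩ := htree.exists_strictlyReduced_of_uniform hε fun M hM i => by
    have a := htl M hM i
    have b := hX.translationLength_le x (M i)
    rcases le_max_iff.1 b with b | b <;> linarith
  obtain ⟨κ, hκ, hbound⟩ := hred.exists_bound htree
  obtain ⟨α, hα⟩ := hM.exists_mulEquiv
  obtain ⟨K, hK, hαK⟩ := FreeGroup.exists_norm_map_le (α : FreeGroup (Fin n) →* FreeGroup (Fin n))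
  have hlow (w : FreeGroup (Fin n)) : κ / K * w.norm ≤ dist x (FreeGroup.lift g w • x) := by
    have a := hbound (α.symm w)
    rw [hα, α.apply_symm_apply] at a
    have b := hαK (α.symm w)
    rw [MonoidHom.coe_coe, α.apply_symm_apply] at b
    refine le_trans ?_ a
    rw [div_mul_eq_mul_div, div_le_iff₀ hK, mul_assoc]
    exact mul_le_mul_of_nonneg_left (by linarith) hκ.le
  have hκK : 0 < κ / K := div_pos hκ hK
  have hinj : Function.Injective (FreeGroup.lift g) := by
    rw [injective_iff_map_eq_one]
    intro w hw
    have := hlow w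
    rw [hw, one_smul, dist_self] at this
    have h0 : (w.norm : ℝ) ≤ 0 := nonpos_of_mul_nonpos_right this hκK
    exact FreeGroup.norm_eq_zero.1 (by exact_mod_cast h0.antisymm (Nat.cast_nonneg _))
  have hsurj : Function.Surjective (FreeGroup.lift g) := by
    rw [← MonoidHom.range_eq_top, FreeGroup.range_lift_eq_closure, hg]
  let e := MulEquiv.ofBijective (FreeGroup.lift g) ⟨hinj, hsurj⟩
  have he (h : G) : FreeGroup.lift g (e.symm h) = h := e.apply_symm_apply h
  have hlow' (y : X) (h : G) :
      κ / K * (e.symm h).norm - 2 * dist x y ≤ dist y (h • y) := by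
    have a := hlow (e.symm h)
    rw [he] at a
    have b := dist_triangle4 x y (h • y) (h • x)
    rw [dist_smul, dist_comm y x] at b
    linarith
  refine ⟨.ofRepr e.symm, fun i => ?_, fun y => ?_, fun y => ?_⟩
  · change FreeGroup.lift g (FreeGroup.of i) = g i
    simp
  · rw [eq_bot_iff]
    intro h hh
    have hpow (m : ℕ) : h ^ m • y = y := (MulAction.stabilizer G y).pow_mem hh m
    -- All powers of h fix y, so the lower bound at y bounds their word lengths.
    have := FreeGroup.eq_one_of_norm_pow_le (w := e.symm h) (C := 2 * dist x y / (κ / K))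
      fun m => by
        have a := hlow' y (h ^ m)
        rw [hpow, dist_self, map_pow] at a
        rw [le_div_iff₀ hκK]
        linarith
    exact Subgroup.mem_bot.2 (by simpa using this)
  · set B := ∑ i, dist y (g i • y) with hB
    have hup (h : G) : dist y (h • y) ≤ B * (e.symm h).norm := by
      have := (hX.isTreeLength (G := G) y).lift_le (M := g) (K := B)
        (fun i => Finset.single_le_sum (f := fun i => dist y (g i • y))
          (fun i _ => dist_nonneg) (Finset.mem_univ i)) (e.symm h)
      rwa [he] at this
    have hdist (u v : G) : dist (u • y) (v • y) = dist y ((u⁻¹ * v) • y) := by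
      rw [← dist_smul u⁻¹, inv_smul_smul, smul_smul]
    refine ⟨max 1 (max (κ / K)⁻¹ B), 2 * dist x y, le_max_left _ _, by positivity,
      fun u v => ?_⟩
    set L := max 1 (max (κ / K)⁻¹ B)
    have hL1 : 1 ≤ L := le_max_left _ _
    have hL2 : (κ / K)⁻¹ ≤ L := (le_max_left _ _).trans (le_max_right _ _)
    have hL3 : B ≤ L := (le_max_right _ _).trans (le_max_right _ _)
    simp only [hdist, freeWordDist]
    set N : ℝ := ((e.symm (u⁻¹ * v)).norm : ℝ)
    have hN : 0 ≤ N := Nat.cast_nonneg _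
    constructor
    · refine le_trans (sub_le_sub_right ?_ _) (hlow' y (u⁻¹ * v))
      rw [div_eq_inv_mul]
      exact mul_le_mul_of_nonneg_right (inv_le_of_inv_le₀ hκK hL2) hN
    · refine (hup _).trans ((mul_le_mul_of_nonneg_right hL3 hN).trans ?_)
      linarith [dist_nonneg (x := x) (y := y)]
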